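/- Let $K$ be a field, let $\Lambda=K\langle x_1,\dots,x_n\rangle$ be the free associative $K$-algebra on $n$ variables, and let $\mathbb{L}$ be the Leavitt algebra of type $(1,n)$ over $K$, that is, the unital associative $K$-algebra generated by $x_1,\dots,x_n,x_1^*,\dots,x_n^*$ subject to the relations $\sum_{i=1}^n x_ix_i^*=1$, $x_i^*x_i=1$ for all $i$, and $x_j^*x_i=0$ for $j\neq i$. For $\lambda\in\Lambda$ write $\lambda$ also for its image in $\mathbb{L}$ under $x_i\mapsto x_i$, and let $\overline\lambda\in\mathbb{L}$ be its image under the algebra homomorphism $\Lambda\to\mathbb{L}$, $x_i\mapsto x_i^*$ (which preserves the order of the letters in each monomial). Suppose that $\lambda\in\Lambda$ has zero constant term and that $\mathbb{L}\lambda\neq\mathbb{L}$ and $\overline\lambda\,\mathbb{L}\neq\mathbb{L}$. Then $\lambda$ has two different factorizations $\lambda=\alpha\beta=\gamma\delta$ into non-invertible elements $\alpha,\beta,\gamma,\delta\in\Lambda$, such that $\alpha$ and $\delta$ have nonzero constant term while $\beta$ and $\gamma$ have zero constant term. Here "different" means that $\gamma$ is not a nonzero scalar multiple of $\alpha$. 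-/

import Mathlib

namespace LeavittFactor

/-- The free algebra `K⟨x₁, …, xₙ⟩`. -/
abbrev Poly (K : Type*) [Field K] (n : ℕ) : Type _ := FreeAlgebra K (Fin n)

/-- The constant term of a noncommutative polynomial: the algebra homomorphism
sending every variable to `0`. -/
def constTerm {K : Type*} [Field K] {n : ℕ} : Poly K n →ₐ[K] K :=
  FreeAlgebra.lift K (fun _ => 0)

/-- The defining relations of the Leavitt algebra. The free generators are indexed by
`Fin n ⊕ Fin n`: `Sum.inl i` stands for `xᵢ` and `Sum.inr i` for `xᵢ*`. -/
inductive LeavittRel (K : Type*) [Field K] (n : ℕ) :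
    FreeAlgebra K (Fin n ⊕ Fin n) → FreeAlgebra K (Fin n ⊕ Fin n) → Prop
  | sum_eq_one : LeavittRel K n
      (∑ i : Fin n, FreeAlgebra.ι K (Sum.inl i) * FreeAlgebra.ι K (Sum.inr i)) 1
  | star_mul_self (i : Fin n) : LeavittRel K n
      (FreeAlgebra.ι K (Sum.inr i) * FreeAlgebra.ι K (Sum.inl i)) 1
  | star_mul_of_ne (i j : Fin n) (h : j ≠ i) : LeavittRel K n
      (FreeAlgebra.ι K (Sum.inr j) * FreeAlgebra.ι K (Sum.inl i)) 0

/-- The Leavitt algebra of type `(1, n)` over `K`: generators `xᵢ, xᵢ*` and relations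
`∑ xᵢ xᵢ* = 1`, `xⱼ* xᵢ = δᵢⱼ`. -/
abbrev Leavitt (K : Type*) [Field K] (n : ℕ) : Type _ := RingQuot (LeavittRel K n)

/-- The canonical map `K⟨x₁, …, xₙ⟩ → 𝕃`, `xᵢ ↦ xᵢ`. -/
def toLeavitt (K : Type*) [Field K] (n : ℕ) : Poly K n →ₐ[K] Leavitt K n :=
  FreeAlgebra.lift K fun i =>
    RingQuot.mkAlgHom K (LeavittRel K n) (FreeAlgebra.ι K (Sum.inl i))

/-- The canonical isomorphism `xᵢ ↦ xᵢ*` of `K⟨x₁, …, xₙ⟩` onto `K⟨x₁*, …, xₙ*⟩`, followed by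
the canonical map of the latter algebra to `𝕃`. It is a homomorphism, so it preserves the order
of the letters of a monomial. -/
def toLeavittStar (K : Type*) [Field K] (n : ℕ) : Poly K n →ₐ[K] Leavitt K n :=
  FreeAlgebra.lift K fun i =>
    RingQuot.mkAlgHom K (LeavittRel K n) (FreeAlgebra.ι K (Sum.inr i))

/-- The principal left ideal `R a`, as a set. -/
def leftMultiples {R : Type*} [Ring R] (a : R) : Set R := Set.range fun r : R => r * a

/-- The principal right ideal `a R`, as a set. -/
def rightMultiples {R : Type*} [Ring R] (a : R) : Set R := Set.range fun r : R => a * r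

end LeavittFactor

namespace LeavittFactor

variable {K : Type*} [Field K] {n : ℕ}

/-! The polynomials with image in `𝕃λ` form a proper left ideal of `Λ`, stable under `∑ xᵢ gᵢ ↦ gⱼ`
because left multiplication by `xⱼ*` extracts `gⱼ`. When nonzero, such an ideal is generated by an
element `δ` of least degree, and `δ` has nonzero constant term
(`exists_generator_constTerm_ne_zero`). Hence `λ = γδ`, and `γ` has zero constant term since `λ`
does. Reversing words turns `λ̄𝕃` into a left ideal of the same kind, which gives `λ = αβ`. The
constant terms of `α` and `γ` tell the factorizations apart. -/

@[simp]
lemma constTerm_ι (i : Fin n) : constTerm (FreeAlgebra.ι K i : Poly K n) = 0 := by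
  simp [constTerm]

/-- The linear map `(c, f) ↦ c + ∑ xᵢ fᵢ`. -/
def assemble (K : Type*) [Field K] (n : ℕ) : K × (Fin n → Poly K n) →ₗ[K] Poly K n :=
  LinearMap.coprod (Algebra.linearMap K (Poly K n))
    (∑ i : Fin n, (LinearMap.mulLeft K (FreeAlgebra.ι K i)).comp (LinearMap.proj i))

lemma assemble_apply (c : K) (f : Fin n → Poly K n) :
    assemble K n (c, f) = algebraMap K _ c + ∑ i, FreeAlgebra.ι K i * f i := by
  simp [assemble]

/-- The polynomials of degree at most `d`. -/
def degreeLE (K : Type*) [Field K] (n : ℕ) : ℕ → Submodule K (Poly K n)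
  | 0 => LinearMap.range (Algebra.linearMap K (Poly K n))
  | d + 1 => (Submodule.prod ⊤ (Submodule.pi Set.univ fun _ => degreeLE K n d)).map (assemble K n)

lemma mem_degreeLE_zero {f : Poly K n} :
    f ∈ degreeLE K n 0 ↔ ∃ c : K, algebraMap K _ c = f := by
  simp [degreeLE]

lemma mem_degreeLE_succ {d : ℕ} {f : Poly K n} :
    f ∈ degreeLE K n (d + 1) ↔ ∃ (c : K) (g : Fin n → Poly K n),
      (∀ i, g i ∈ degreeLE K n d) ∧ algebraMap K _ c + ∑ i, FreeAlgebra.ι K i * g i = f := by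
  simp [degreeLE, assemble_apply, Submodule.mem_map, Submodule.mem_prod, Submodule.mem_pi]

lemma degreeLE_mono : Monotone (degreeLE K n) := by
  refine monotone_nat_of_le_succ fun d => ?_
  induction d with
  | zero =>
    intro f hf
    obtain ⟨c, rfl⟩ := mem_degreeLE_zero.1 hf
    exact mem_degreeLE_succ.2 ⟨c, 0, fun _ => Submodule.zero_mem _, by simp⟩
  | succ d ih =>
    intro f hf
    obtain ⟨c, g, hg, rfl⟩ := mem_degreeLE_succ.1 hf
    exact mem_degreeLE_succ.2 ⟨c, g, fun i => ih (hg i), rfl⟩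

lemma ι_mul_mem_degreeLE {d : ℕ} {f : Poly K n} (hf : f ∈ degreeLE K n d) (i : Fin n) :
    FreeAlgebra.ι K i * f ∈ degreeLE K n (d + 1) := by
  classical
  refine mem_degreeLE_succ.2 ⟨0, Pi.single i f, fun j => ?_, ?_⟩
  · rcases eq_or_ne j i with rfl | h
    · simpa using hf
    · simp [h]
  · rw [map_zero, zero_add, Finset.sum_eq_single i] <;> simp +contextual

/-- The recursion in `degreeLE` adds letters on the left; the extra factor `g` lets the induction on
`f` pass through products. -/
lemma exists_mul_mem_degreeLE (f : Poly K n) :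
    ∀ (d : ℕ) (g : Poly K n), g ∈ degreeLE K n d → ∃ e, f * g ∈ degreeLE K n e := by
  induction f using FreeAlgebra.induction with
  | grade0 c =>
    intro d g hg
    exact ⟨d, by simpa [← Algebra.smul_def] using Submodule.smul_mem _ c hg⟩
  | grade1 i => exact fun d g hg => ⟨d + 1, ι_mul_mem_degreeLE hg i⟩
  | mul a b ha hb =>
    intro d g hg
    obtain ⟨e, he⟩ := hb d g hg
    obtain ⟨e', he'⟩ := ha e _ he
    exact ⟨e', by rwa [mul_assoc]⟩
  | add a b ha hb =>
    intro d g hg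
    obtain ⟨e, he⟩ := ha d g hg
    obtain ⟨e', he'⟩ := hb d g hg
    refine ⟨max e e', ?_⟩
    rw [add_mul]
    exact Submodule.add_mem _ (degreeLE_mono (le_max_left _ _) he)
      (degreeLE_mono (le_max_right _ _) he')

lemma exists_mem_degreeLE (f : Poly K n) : ∃ d, f ∈ degreeLE K n d := by
  simpa using exists_mul_mem_degreeLE f 0 1 (mem_degreeLE_zero.2 ⟨1, by simp⟩)

lemma exists_sum_eq_of_constTerm_eq_zero {d : ℕ} {f : Poly K n} (hf : f ∈ degreeLE K n (d + 1))
    (h : constTerm f = 0) : ∃ g : Fin n → Poly K n,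
      (∀ i, g i ∈ degreeLE K n d) ∧ ∑ i, FreeAlgebra.ι K i * g i = f := by
  obtain ⟨c, g, hg, rfl⟩ := mem_degreeLE_succ.1 hf
  obtain rfl : c = 0 := by simpa using h
  exact ⟨g, hg, by simp⟩

/-- A nonzero proper left ideal which contains the coefficients `fᵢ` of each of its elements of
the form `∑ xᵢ fᵢ` is generated by an element with nonzero constant term. -/
lemma exists_generator_constTerm_ne_zero (J : Ideal (Poly K n)) (hbot : J ≠ ⊥) (htop : J ≠ ⊤)
    (hJ : ∀ g : Fin n → Poly K n, ∑ i, FreeAlgebra.ι K i * g i ∈ J → ∀ i, g i ∈ J) :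
    ∃ δ, J = Ideal.span {δ} ∧ constTerm δ ≠ 0 := by
  classical
  have hex : ∃ d, ∃ f ∈ J, f ∈ degreeLE K n d ∧ f ≠ 0 := by
    obtain ⟨f, hf, h0⟩ := Submodule.exists_mem_ne_zero_of_ne_bot hbot
    obtain ⟨d, hd⟩ := exists_mem_degreeLE f
    exact ⟨d, f, hf, hd, h0⟩
  obtain ⟨δ, hδJ, hδd, hδ0⟩ := Nat.find_spec hex
  have hmin : ∀ e < Nat.find hex, ∀ f ∈ J, f ∈ degreeLE K n e → f = 0 := by
    intro e he f hf hfe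
    by_contra h
    exact Nat.find_min hex he ⟨f, hf, hfe, h⟩
  generalize Nat.find hex = d at hδd hmin
  cases d with
  | zero =>
    obtain ⟨c, rfl⟩ := mem_degreeLE_zero.1 hδd
    have hc : c ≠ 0 := by
      rintro rfl
      simp at hδ0
    exact absurd (Ideal.eq_top_of_isUnit_mem _ hδJ ((isUnit_iff_ne_zero.2 hc).map _)) htop
  | succ e =>
    -- Otherwise the coefficients of `δ` lie in `J` with smaller degree, so they vanish and `δ = 0`.
    have hc : constTerm δ ≠ 0 := by
      intro h
      obtain ⟨g, hg, rfl⟩ := exists_sum_eq_of_constTerm_eq_zero hδd h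
      refine hδ0 (Finset.sum_eq_zero fun i _ => ?_)
      rw [hmin e (Nat.lt_succ_self e) _ (hJ g hδJ i) (hg i), mul_zero]
    refine ⟨δ, le_antisymm (fun f hf => ?_) ((Ideal.span_singleton_le_iff_mem J).2 hδJ), hc⟩
    have key : ∀ m, ∀ f ∈ J, f ∈ degreeLE K n (e + m) → f ∈ Ideal.span {δ} := by
      intro m
      induction m with
      | zero =>
        intro f hf hfm
        rw [hmin e (Nat.lt_succ_self e) f hf hfm]
        exact Submodule.zero_mem _
      | succ m ih =>
        intro f hf hfm
        -- Subtracting this multiple kills the constant term of `f`; the coefficients of the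
        -- difference lie in `J` in lower degree, where `ih` applies.
        have hcδ : (constTerm f / constTerm δ) • δ ∈ Ideal.span {δ} := by
          rw [Algebra.smul_def]
          exact Ideal.mul_mem_left _ _ (Ideal.mem_span_singleton_self δ)
        have hsub : f - (constTerm f / constTerm δ) • δ ∈ J :=
          J.sub_mem hf ((Ideal.span_singleton_le_iff_mem J).2 hδJ hcδ)
        obtain ⟨g, hg, hsum⟩ := exists_sum_eq_of_constTerm_eq_zero
          (Submodule.sub_mem _ hfm (Submodule.smul_mem _ (constTerm f / constTerm δ)
            (degreeLE_mono (show e + 1 ≤ e + (m + 1) by lia) hδd)))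
          (by simp [hc])
        rw [← sub_add_cancel f ((constTerm f / constTerm δ) • δ)]
        refine Ideal.add_mem _ ?_ hcδ
        rw [← hsum]
        exact Ideal.sum_mem _ fun i _ => Ideal.mul_mem_left _ _
          (ih _ (hJ g (hsum ▸ hsub) i) (hg i))
    obtain ⟨m, hm⟩ := exists_mem_degreeLE f
    exact key m f hf (degreeLE_mono (Nat.le_add_left m e) hm)

lemma exists_nonunit_constTerm_ne_zero (hn : 0 < n) :
    ∃ δ : Poly K n, ¬ IsUnit δ ∧ constTerm δ ≠ 0 := by
  refine ⟨1 + FreeAlgebra.ι K ⟨0, hn⟩, fun h => ?_, by simp⟩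
  -- Evaluation at `xᵢ = -1` sends `1 + x₀` to `0`.
  simpa using h.map (FreeAlgebra.lift K fun _ : Fin n => (-1 : K))

lemma exists_right_factor (hn : 0 < n) {J : Ideal (Poly K n)} (htop : J ≠ ⊤)
    (hJ : ∀ g : Fin n → Poly K n, ∑ i, FreeAlgebra.ι K i * g i ∈ J → ∀ i, g i ∈ J)
    {p : Poly K n} (hp : p ∈ J) :
    ∃ γ δ, p = γ * δ ∧ ¬ IsUnit δ ∧ constTerm δ ≠ 0 := by
  -- The zero ideal forces `p = 0`, which factors as `0 * δ` for any suitable `δ`.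
  by_cases hbot : J = ⊥
  · obtain ⟨δ, hu, hc⟩ := exists_nonunit_constTerm_ne_zero (K := K) hn
    exact ⟨0, δ, by simpa [hbot] using hp, hu, hc⟩
  · obtain ⟨δ, rfl, hc⟩ := exists_generator_constTerm_ne_zero J hbot htop hJ
    obtain ⟨γ, rfl⟩ := Ideal.mem_span_singleton'.1 hp
    exact ⟨γ, δ, rfl, fun hu => htop
      (Ideal.eq_top_of_isUnit_mem _ (Ideal.mem_span_singleton_self δ) hu), hc⟩

lemma toLeavittStar_mul_toLeavitt (i j : Fin n) :
    toLeavittStar K n (FreeAlgebra.ι K j) * toLeavitt K n (FreeAlgebra.ι K i) =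
      if j = i then 1 else 0 := by
  simp only [toLeavittStar, toLeavitt, FreeAlgebra.lift_ι_apply, ← map_mul]
  split_ifs with h
  · subst h
    rw [RingQuot.mkAlgHom_rel K (LeavittRel.star_mul_self j), map_one]
  · rw [RingQuot.mkAlgHom_rel K (LeavittRel.star_mul_of_ne i j h), map_zero]

lemma subsingleton_leavitt_zero : Subsingleton (Leavitt K 0) := by
  refine subsingleton_of_zero_eq_one ?_
  simpa using RingQuot.mkAlgHom_rel K (LeavittRel.sum_eq_one (K := K) (n := 0))

/-- The polynomials whose image in the Leavitt algebra lies in the left ideal generated by `a`. -/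
def leftIdeal (a : Leavitt K n) : Ideal (Poly K n) where
  carrier := {f | ∃ r, r * a = toLeavitt K n f}
  zero_mem' := ⟨0, by simp⟩
  add_mem' := by
    rintro f g ⟨r, hr⟩ ⟨s, hs⟩
    exact ⟨r + s, by rw [add_mul, hr, hs, map_add]⟩
  smul_mem' := by
    rintro g f ⟨r, hr⟩
    exact ⟨toLeavitt K n g * r, by rw [mul_assoc, hr, smul_eq_mul, map_mul]⟩

lemma mem_leftIdeal {a : Leavitt K n} {f : Poly K n} :
    f ∈ leftIdeal a ↔ ∃ r, r * a = toLeavitt K n f := Iff.rfl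

lemma mem_leftIdeal_of_sum {a : Leavitt K n} (g : Fin n → Poly K n)
    (h : ∑ i, FreeAlgebra.ι K i * g i ∈ leftIdeal a) (i : Fin n) : g i ∈ leftIdeal a := by
  obtain ⟨r, hr⟩ := mem_leftIdeal.1 h
  refine ⟨toLeavittStar K n (FreeAlgebra.ι K i) * r, ?_⟩
  simp [mul_assoc, hr, Finset.mul_sum, ← mul_assoc (toLeavittStar K n _),
    toLeavittStar_mul_toLeavitt]

lemma leftIdeal_ne_top {a : Leavitt K n} (h : leftMultiples a ≠ Set.univ) : leftIdeal a ≠ ⊤ := by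
  intro htop
  obtain ⟨r, hr⟩ := mem_leftIdeal.1 ((Ideal.eq_top_iff_one _).1 htop)
  exact h (Set.eq_univ_of_forall fun x => ⟨x * r, by simp [mul_assoc, hr]⟩)

/-- The polynomials whose reversal has its image under `xᵢ ↦ xᵢ*` in the right ideal generated
by `a`. -/
def reversedRightIdeal (a : Leavitt K n) : Ideal (Poly K n) where
  carrier := {f | ∃ r, a * r = toLeavittStar K n (star f)}
  zero_mem' := ⟨0, by simp⟩
  add_mem' := by
    rintro f g ⟨r, hr⟩ ⟨s, hs⟩
    exact ⟨r + s, by rw [mul_add, hr, hs, star_add, map_add]⟩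
  smul_mem' := by
    rintro g f ⟨r, hr⟩
    exact ⟨r * toLeavittStar K n (star g), by
      rw [← mul_assoc, hr, smul_eq_mul, star_mul, map_mul]⟩

lemma mem_reversedRightIdeal {a : Leavitt K n} {f : Poly K n} :
    f ∈ reversedRightIdeal a ↔ ∃ r, a * r = toLeavittStar K n (star f) := Iff.rfl

/-- Reversal puts the first letter last, as `xᵢ*`, so right multiplication by `xᵢ` extracts the
coefficient. -/
lemma mem_reversedRightIdeal_of_sum {a : Leavitt K n} (g : Fin n → Poly K n)
    (h : ∑ i, FreeAlgebra.ι K i * g i ∈ reversedRightIdeal a) (i : Fin n) :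
    g i ∈ reversedRightIdeal a := by
  obtain ⟨r, hr⟩ := mem_reversedRightIdeal.1 h
  refine ⟨r * toLeavitt K n (FreeAlgebra.ι K i), ?_⟩
  rw [← mul_assoc, hr]
  simp [Finset.sum_mul, mul_assoc, toLeavittStar_mul_toLeavitt]

lemma reversedRightIdeal_ne_top {a : Leavitt K n} (h : rightMultiples a ≠ Set.univ) :
    reversedRightIdeal a ≠ ⊤ := by
  intro htop
  obtain ⟨r, hr⟩ := mem_reversedRightIdeal.1 ((Ideal.eq_top_iff_one _).1 htop)
  exact h (Set.eq_univ_of_forall fun x => ⟨r * x, by simp [← mul_assoc, hr]⟩)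

lemma constTerm_star (f : Poly K n) : constTerm (star f) = constTerm f := by
  induction f using FreeAlgebra.induction with
  | grade0 c => rw [FreeAlgebra.star_algebraMap]
  | grade1 i => rw [FreeAlgebra.star_ι]
  | mul a b ha hb => rw [star_mul, map_mul, map_mul, ha, hb, mul_comm]
  | add a b ha hb => rw [star_add, map_add, map_add, ha, hb]

end LeavittFactor

theorem proposition4p20 {K : Type*} [Field K] (n : ℕ) (p : LeavittFactor.Poly K n)
    (hp : LeavittFactor.constTerm p = 0)
    (hleft : LeavittFactor.leftMultiples (LeavittFactor.toLeavitt K n p) ≠ Set.univ)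
    (hright : LeavittFactor.rightMultiples (LeavittFactor.toLeavittStar K n p) ≠ Set.univ) :
    ∃ α β γ δ : LeavittFactor.Poly K n,
      p = α * β ∧ p = γ * δ ∧
      ¬ IsUnit α ∧ ¬ IsUnit β ∧ ¬ IsUnit γ ∧ ¬ IsUnit δ ∧
      LeavittFactor.constTerm α ≠ 0 ∧ LeavittFactor.constTerm δ ≠ 0 ∧
      LeavittFactor.constTerm β = 0 ∧ LeavittFactor.constTerm γ = 0 ∧
      (∀ c : K, c ≠ 0 → γ ≠ c • α) := by
  open LeavittFactor in
  -- For `n = 0` the empty sum gives `0 = 1` in `𝕃`, contradicting `hleft`.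
  have hn : 0 < n := by
    rcases Nat.eq_zero_or_pos n with rfl | h
    · have := subsingleton_leavitt_zero (K := K)
      exact (hleft (Set.eq_univ_of_forall fun x => ⟨0, Subsingleton.elim _ _⟩)).elim
    · exact h
  have not_isUnit {f : Poly K n} (hf : constTerm f = 0) : ¬ IsUnit f := fun h =>
    (h.map constTerm).ne_zero hf
  obtain ⟨γ, δ, hγδ, hδu, hδ⟩ := exists_right_factor hn (leftIdeal_ne_top hleft)
    mem_leftIdeal_of_sum (p := p) ⟨1, one_mul _⟩
  obtain ⟨β, α, hβα, hαu, hα⟩ := exists_right_factor hn (reversedRightIdeal_ne_top hright)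
    mem_reversedRightIdeal_of_sum (p := star p) ⟨1, by rw [mul_one, star_star]⟩
  have hαβ : p = star α * star β := by rw [← star_mul, ← hβα, star_star]
  rw [← constTerm_star] at hα
  have hγ : constTerm γ = 0 := by
    rw [hγδ, map_mul] at hp
    exact (mul_eq_zero.1 hp).resolve_right hδ
  have hβ : constTerm (star β) = 0 := by
    rw [hαβ, map_mul] at hp
    exact (mul_eq_zero.1 hp).resolve_left hα
  refine ⟨star α, star β, γ, δ, hαβ, hγδ, ?_, not_isUnit hβ, not_isUnit hγ, hδu, hα, hδ, hβ, hγ,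
    fun c hc h => ?_⟩
  · rwa [isUnit_star]
  -- A nonzero multiple of `α` has nonzero constant term, unlike `γ`.
  · rw [h, map_smul, smul_eq_mul] at hγ
    exact mul_ne_zero hc hα hγ
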